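/- Let $A$ be a unital $C^*$-algebra and let $V$ be a Hilbert $A$-module: an $A$-module with an $A$-valued inner product $\langle\cdot,\cdot\rangle$ that is $A$-linear in the second variable, satisfies $\langle x,y\rangle^*=\langle y,x\rangle$, is positive ($\langle x,x\rangle\ge 0$) and definite ($\langle x,x\rangle=0$ only for $x=0$), such that $V$ is complete for the norm $\|x\|=\|\langle x,x\rangle\|^{1/2}$. (The statement is formalized for left modules, so $\langle x,ay\rangle=a\langle x,y\rangle$; a right Hilbert $A$-module is the same thing as a left Hilbert module over the opposite $C^*$-algebra.) Let $\tau_{\widehat V}$ be the locally convex topology on $V$ generated by the seminorms $x\mapsto\|\langle z,x\rangle\|$, $z\in V$. Suppose that $V$ is countably generated (there is a sequence in $V$ whose finite $A$-linear combinations are norm-dense in $V$) and that $V$ has the module Schur property (every sequence in $V$ that converges to an element of $V$ with respect to $\tau_{\widehat V}$ converges in norm). Then $V$ is self-dual: for every bounded $A$-linear map $f:V\to A$ there is $x\in V$ such that $f(y)=\langle x,y\rangle$ for all $y\in V$. -/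

import Mathlib

open Filter Topology

namespace HilbertCStar

section

variable (A E : Type*) [CStarAlgebra A] [PartialOrder A] [StarOrderedRing A]
  [NormedAddCommGroup E] [NormedSpace ℂ E] [Module A E] [CStarModule A E]

/-- The seminorms `μ_z (x) = ‖⟪z, x⟫‖` on a Hilbert `A`-module `E`, indexed by `z : E`. -/
noncomputable def innerSeminorms : SeminormFamily ℂ E E := fun z =>
  (normSeminorm ℂ A).comp (CStarModule.innerₛₗ (A := A) z)

/-- The locally convex topology on a Hilbert `A`-module `E` generated by the seminorms
`x ↦ ‖⟪z, x⟫‖`, `z ∈ E`. It is passed explicitly and is not an instance: the topology found by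
instance search on `E` is always the norm topology. -/
noncomputable abbrev weakModuleTopology : TopologicalSpace E :=
  (innerSeminorms A E).moduleFilterBasis.topology

/-- Module Schur property: every sequence in `E` that converges in the weak module topology
converges in norm. -/
def ModuleSchur : Prop :=
  ∀ u : ℕ → E, (∃ x : E, Tendsto u atTop (@nhds E (weakModuleTopology A E) x)) →
    ∃ y : E, Tendsto u atTop (𝓝 y)

/-- `E` is countably generated: the finite `A`-linear combinations of the members of some sequence
are norm-dense in `E`. -/
def CountablyGenerated : Prop :=
  ∃ g : ℕ → E, Dense (Submodule.span A (Set.range g) : Set E)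

/-- `E` is self-dual: each bounded `A`-linear map `f : E → A` is `y ↦ ⟪x, y⟫` for some `x ∈ E`. -/
def SelfDual : Prop :=
  ∀ f : E →L[A] A, ∃ x : E, ∀ y : E, f y = inner A x y

end

end HilbertCStar

/-!
Scale the generators so that `∑ ‖g i‖ ^ 2 ≤ 1`. Then `G n = ∑ i < n, ⟪g i, ·⟫ • g i` satisfies
`0 ≤ G n ≤ 1`, and since `G n` dominates each of its summands, `k ‖(1 - G n) ^ k (g i)‖ ^ 2 ≤ 1`
for `i < n`. Hence `(1 - G n) ^ (2 ^ n)` tends to zero pointwise. These operators are symmetric, so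
the Schur property makes the convergence uniform, and `‖(1 - G n) ^ (2 ^ n)‖ ≤ 1 / 2` for some `n`.
Applying `‖T x‖ ^ 2 ≤ ‖x‖ ‖T (T x)‖` to the powers of `T = 1 - G n` whose exponents are powers of
two brings this down to `‖1 - G n‖ < 1`.

The operator `G = G n` has finite rank and `A` is complete, so `G` maps Cauchy sequences to
convergent ones. By a Neumann series argument `E` is then complete and `G` is surjective. Now
`f ∘ G` is the inner product with `∑ i < n, star (f (g i)) • g i`. Writing this vector as `G x`
gives `f (G z) = ⟪G x, z⟫ = ⟪x, G z⟫`, that is, `f = ⟪x, ·⟫`.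
-/

namespace HilbertCStar

section NormedSpace

variable {𝕜 F : Type*} [NontriviallyNormedField 𝕜] [NormedAddCommGroup F] [NormedSpace 𝕜 F]

lemma one_sub_norm_mul_norm_le (T : F →L[𝕜] F) (x : F) :
    (1 - ‖T‖) * ‖x‖ ≤ ‖(1 - T) x‖ := by
  have hTx := T.le_opNorm x
  have htri : ‖x‖ - ‖T x‖ ≤ ‖(1 - T) x‖ := norm_sub_norm_le x (T x)
  linarith

lemma cauchySeq_of_cauchySeq_one_sub {T : F →L[𝕜] F} (hT : ‖T‖ < 1) {u : ℕ → F}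
    (hu : CauchySeq fun n => (1 - T : F →L[𝕜] F) (u n)) : CauchySeq u := by
  have hanti : AntilipschitzWith (1 - ‖T‖)⁻¹.toNNReal (1 - T : F →L[𝕜] F) := by
    refine ContinuousLinearMap.antilipschitz_of_bound _ fun x => ?_
    rw [Real.coe_toNNReal _ (inv_nonneg.2 (sub_nonneg.2 hT.le)),
      le_inv_mul_iff₀ (sub_pos.2 hT)]
    exact one_sub_norm_mul_norm_le T x
  exact (hanti.isUniformInducing (1 - T).uniformContinuous).cauchy_map_iff.1 hu

lemma tendsto_pow_apply_zero_of_cauchySeq {T : F →L[𝕜] F} (hT : ‖T‖ < 1) {u : ℕ → F}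
    (hu : CauchySeq u) : Tendsto (fun n => (T ^ n) (u n)) atTop (𝓝 0) := by
  obtain ⟨C, hC⟩ := hu.isBounded_range.exists_norm_le
  have hpow : Tendsto (fun n => ‖T ^ n‖ * C) atTop (𝓝 0) := by
    simpa using (tendsto_pow_atTop_nhds_zero_of_norm_lt_one hT).norm.mul_const C
  exact squeeze_zero_norm
    (fun n => (T ^ n).le_opNorm_of_le (hC _ (Set.mem_range_self n))) hpow

lemma completeSpace_of_tendsto_one_sub {T : F →L[𝕜] F} (hT : ‖T‖ < 1)
    (h : ∀ u : ℕ → F, CauchySeq u → ∃ y, Tendsto (fun n => (1 - T : F →L[𝕜] F) (u n)) atTop (𝓝 y)) :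
    CompleteSpace F := by
  refine UniformSpace.complete_of_cauchySeq_tendsto fun u hu => ?_
  set w : ℕ → F := fun n => (∑ k ∈ Finset.range n, T ^ k) (u n)
  have hw (n : ℕ) : (1 - T) (w n) = u n - (T ^ n) (u n) := by
    rw [← mul_apply_eq_comp, mul_neg_geom_sum]
    rfl
  have hpow := tendsto_pow_apply_zero_of_cauchySeq hT hu
  have hw_cauchy : CauchySeq w := by
    refine cauchySeq_of_cauchySeq_one_sub hT ?_
    simp only [hw]
    exact (uniformContinuous_sub.comp_cauchySeq (hu.prodMk hpow.cauchySeq))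
  obtain ⟨y, hy⟩ := h w hw_cauchy
  refine ⟨y, ?_⟩
  simpa only [hw, sub_add_cancel, add_zero] using hy.add hpow

lemma surjective_one_sub_of_norm_lt_one [CompleteSpace F] {T : F →L[𝕜] F} (hT : ‖T‖ < 1) :
    Function.Surjective (1 - T : F →L[𝕜] F) :=
  (ContinuousLinearMap.isUnit_iff_bijective.1 (isUnit_one_sub_of_norm_lt_one hT)).surjective

variable (𝕜) in
lemma exists_ne_zero_norm_smul_sq_le (x : F) {δ : ℝ} (hδ : 0 < δ) :
    ∃ r : 𝕜, r ≠ 0 ∧ ‖r • x‖ ^ 2 ≤ δ := by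
  have hcont : Continuous fun r : 𝕜 => ‖r • x‖ ^ 2 := by fun_prop
  have hnear : ∀ᶠ r in 𝓝 (0 : 𝕜), ‖r • x‖ ^ 2 < δ :=
    hcont.continuousAt.eventually_lt continuousAt_const (by simpa using hδ)
  obtain ⟨r, hr, hr0⟩ := ((hnear.filter_mono nhdsWithin_le_nhds).and
    (self_mem_nhdsWithin (s := {0}ᶜ))).exists
  exact ⟨r, hr0, hr.le⟩

end NormedSpace

section DenseSpan

variable {R M : Type*} [SeminormedRing R] [SeminormedAddCommGroup M] [Module R M]
  [IsBoundedSMul R M]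

lemma tendsto_apply_zero_of_dense_span {ι : Type*} {l : Filter ι} {S : ι → M →ₗ[R] M} {C : ℝ}
    (hS : ∀ i x, ‖S i x‖ ≤ C * ‖x‖) {s : Set M} (hs : Dense (Submodule.span R s : Set M))
    (h : ∀ x ∈ s, Tendsto (fun i => S i x) l (𝓝 0)) (x : M) :
    Tendsto (fun i => S i x) l (𝓝 0) := by
  have hequi : Equicontinuous fun i => ⇑(S i) :=
    (LipschitzWith.uniformEquicontinuous (fun i => ⇑(S i)) C.toNNReal fun i =>
      AddMonoidHomClass.lipschitz_of_bound (S i) C (hS i)).equicontinuous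
  have hspan : ∀ y ∈ Submodule.span R s, Tendsto (fun i => S i y) l (𝓝 0) := by
    intro y hy
    induction hy using Submodule.span_induction with
    | mem y hy => exact h y hy
    | zero => simp only [map_zero, tendsto_const_nhds]
    | add y z _ _ hy hz => simpa only [map_add, add_zero] using hy.add hz
    | smul a y _ hy => simpa only [map_smul, smul_zero] using hy.const_smul a
  have hclosed := hequi.isClosed_setOfPred_tendsto (l := l) (continuous_const (y := (0 : M)))
  exact hclosed.closure_subset_iff.2 hspan (hs x)

end DenseSpan

section CStarModule

open CStarModule

section Algebraic

variable {A E : Type*} [CStarAlgebra A] [PartialOrder A]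
  [NormedAddCommGroup E] [NormedSpace ℂ E] [Module A E] [CStarModule A E]

variable (A) in
lemma ext_inner_left {x y : E} (h : ∀ z : E, inner A z x = inner A z y) : x = y := by
  rw [← sub_eq_zero, ← CStarModule.inner_self (A := A), CStarModule.inner_sub_right, h, sub_self]

instance : IsScalarTower ℂ A E where
  smul_assoc c a x := ext_inner_left A fun z => by simp

instance : IsBoundedSMul A E :=
  .of_norm_smul_le fun a x => by
    refine (pow_le_pow_iff_left₀ (norm_nonneg _) (by positivity) two_ne_zero).1 ?_
    calc ‖a • x‖ ^ 2 = ‖a * (inner A x x * star a)‖ := by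
          rw [norm_sq_eq A, inner_op_smul_right, inner_op_smul_left]
      _ ≤ ‖a‖ * (‖inner A x x‖ * ‖star a‖) := norm_mul_le_of_le le_rfl (norm_mul_le _ _)
      _ = (‖a‖ * ‖x‖) ^ 2 := by rw [norm_star, mul_pow, norm_sq_eq A (x := x)]; ring

/-- A module endomorphism is symmetric if it is its own adjoint for the `A`-valued inner product.
It is not assumed to be bounded. -/
def IsSymmetric (T : Module.End A E) : Prop :=
  ∀ x y, inner A (T x) y = inner A x (T y)

namespace IsSymmetric

variable {T : Module.End A E}

lemma pow (hT : IsSymmetric T) (k : ℕ) : IsSymmetric (T ^ k) := by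
  induction k with
  | zero => exact fun _ _ => rfl
  | succ k ih =>
    intro x y
    rw [pow_succ, Module.End.mul_apply, ih, hT, ← Module.End.mul_apply, ← pow_succ', ← pow_succ]

lemma one_sub (hT : IsSymmetric T) : IsSymmetric (1 - T) := fun x y => by
  simp [hT x y]

end IsSymmetric

/-- Endomorphisms `G` with `0 ≤ G ≤ 1`, the order being that of the quadratic forms
`x ↦ ⟪x, G x⟫`. -/
structure IsPositiveContraction (G : Module.End A E) : Prop where
  isSymmetric : IsSymmetric G
  inner_nonneg (x : E) : 0 ≤ inner A x (G x)
  inner_le (x : E) : inner A x (G x) ≤ inner A x x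

variable (A) in
/-- The frame operator `x ↦ ∑ i ∈ s, ⟪g i, x⟫ • g i` of a finite family of vectors, that is, the
sum of the rank-one operators attached to them. -/
def frameOperator {ι : Type*} (g : ι → E) (s : Finset ι) : Module.End A E where
  toFun x := ∑ i ∈ s, inner A (g i) x • g i
  map_add' x y := by simp only [CStarModule.inner_add_right, add_smul, Finset.sum_add_distrib]
  map_smul' a x := by simp only [inner_op_smul_right, mul_smul, Finset.smul_sum, RingHom.id_apply]

section FrameOperator

variable {ι : Type*} (g : ι → E) (s : Finset ι)

lemma frameOperator_apply (x : E) :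
    frameOperator A g s x = ∑ i ∈ s, inner A (g i) x • g i := rfl

lemma inner_frameOperator (x : E) :
    inner A x (frameOperator A g s x) = ∑ i ∈ s, inner A (g i) x * inner A x (g i) := by
  simp only [frameOperator_apply, inner_sum_right, inner_op_smul_right]

lemma isSymmetric_frameOperator : IsSymmetric (frameOperator A g s) := fun x y => by
  simp only [frameOperator_apply, inner_sum_left, inner_sum_right, inner_op_smul_left,
    inner_op_smul_right, star_inner]

lemma map_frameOperator (f : E →ₗ[A] A) (x : E) :
    f (frameOperator A g s x) = inner A (∑ i ∈ s, star (f (g i)) • g i) x := by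
  simp only [frameOperator_apply, map_sum, map_smul, smul_eq_mul, inner_sum_left,
    inner_op_smul_left, star_star]

end FrameOperator

lemma CountablyGenerated.exists_sum_norm_sq_le_one (h : CountablyGenerated A E) :
    ∃ g : ℕ → E, Dense (Submodule.span A (Set.range g) : Set E) ∧
      ∀ s : Finset ℕ, ∑ i ∈ s, ‖g i‖ ^ 2 ≤ 1 := by
  obtain ⟨g, hg⟩ := h
  obtain ⟨δ, hδ, c, hsum, hc⟩ := posSumOfEncodable one_pos ℕ
  choose r hr0 hr using fun i => exists_ne_zero_norm_smul_sq_le ℂ (g i) (hδ i)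
  refine ⟨fun i => r i • g i, hg.mono (Submodule.span_le.2 ?_), fun s => ?_⟩
  · rintro _ ⟨i, rfl⟩
    rw [← inv_smul_smul₀ (hr0 i) (g i)]
    exact Submodule.smul_of_tower_mem _ _ (Submodule.subset_span ⟨i, rfl⟩)
  · calc ∑ i ∈ s, ‖r i • g i‖ ^ 2 ≤ ∑ i ∈ s, δ i := Finset.sum_le_sum fun i _ => hr i
      _ ≤ c := sum_le_hasSum s (fun i _ => (hδ i).le) hsum
      _ ≤ 1 := hc

lemma tendsto_weakModuleTopology_iff {u : ℕ → E} {x : E} :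
    Tendsto u atTop (@nhds E (weakModuleTopology A E) x) ↔
      ∀ z : E, Tendsto (fun n => inner A z (u n - x)) atTop (𝓝 0) := by
  let := weakModuleTopology A E
  have hp : WithSeminorms (innerSeminorms A E) := ⟨rfl⟩
  simp only [hp.tendsto_nhds, Metric.tendsto_nhds, dist_zero_right]
  rfl

theorem selfDual_of_surjective_frameOperator {ι : Type*} {g : ι → E} {s : Finset ι}
    (h : Function.Surjective (frameOperator A g s)) : SelfDual A E := by
  intro f
  obtain ⟨x, hx⟩ := h (∑ i ∈ s, star (f (g i)) • g i)
  refine ⟨x, fun y => ?_⟩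
  obtain ⟨z, rfl⟩ := h y
  calc f (frameOperator A g s z) = inner A (frameOperator A g s x) z := by
        rw [hx]; exact map_frameOperator g s f.toLinearMap z
    _ = inner A x (frameOperator A g s z) := isSymmetric_frameOperator g s x z

end Algebraic

section Ordered

variable {A E : Type*} [CStarAlgebra A] [PartialOrder A] [StarOrderedRing A]
  [NormedAddCommGroup E] [NormedSpace ℂ E] [Module A E] [CStarModule A E]

lemma norm_le_of_inner_self_le {x y : E} (h : inner A x x ≤ inner A y y) : ‖x‖ ≤ ‖y‖ := by
  rw [norm_eq_sqrt_norm_inner_self (A := A), norm_eq_sqrt_norm_inner_self (A := A) y]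
  exact Real.sqrt_le_sqrt
    (CStarAlgebra.norm_le_norm_of_nonneg_of_le CStarModule.inner_self_nonneg h)

lemma inner_mul_inner_swap_nonneg (g x : E) : 0 ≤ inner A g x * inner A x g := by
  rw [← star_inner x g]
  exact star_mul_self_nonneg _

namespace IsSymmetric

variable {T : Module.End A E}

lemma norm_apply_sq_le (hT : IsSymmetric T) (x : E) : ‖T x‖ ^ 2 ≤ ‖x‖ * ‖T (T x)‖ := by
  rw [norm_sq_eq A, hT]
  exact norm_inner_le E

lemma norm_apply_le_of_norm_pow_two_pow_apply_le (hT : IsSymmetric T) {c : ℝ} (hc : 0 ≤ c) {n : ℕ}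
    (h : ∀ x, ‖(T ^ 2 ^ n) x‖ ≤ c ^ 2 ^ n * ‖x‖) (x : E) : ‖T x‖ ≤ c * ‖x‖ := by
  induction n with
  | zero => simpa using h x
  | succ n ih =>
    refine ih fun y => ?_
    refine (pow_le_pow_iff_left₀ (norm_nonneg _) (by positivity) two_ne_zero).1 ?_
    calc ‖(T ^ 2 ^ n) y‖ ^ 2 ≤ ‖y‖ * ‖(T ^ 2 ^ (n + 1)) y‖ := by
          rw [pow_succ 2 n, pow_mul, pow_two (T ^ 2 ^ n)]
          exact (hT.pow _).norm_apply_sq_le y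
      _ ≤ ‖y‖ * (c ^ 2 ^ (n + 1) * ‖y‖) := by gcongr; exact h y
      _ = (c ^ 2 ^ n * ‖y‖) ^ 2 := by ring

end IsSymmetric

namespace IsPositiveContraction

variable {G : Module.End A E}

lemma one_sub (hG : IsPositiveContraction G) : IsPositiveContraction (1 - G) where
  isSymmetric := hG.isSymmetric.one_sub
  inner_nonneg x := by simpa using hG.inner_le x
  inner_le x := by simpa using hG.inner_nonneg x

lemma inner_apply_self_add_le (hG : IsPositiveContraction G) (x : E) :
    inner A (G x) (G x) + inner A ((1 - G) x) (G ((1 - G) x)) ≤ inner A x (G x) := by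
  have hnonneg := hG.one_sub.inner_nonneg (G x)
  have hidentity : inner A x (G x) - (inner A (G x) (G x) + inner A ((1 - G) x) (G ((1 - G) x))) =
      inner A (G x) ((1 - G) (G x)) := by
    simp only [hG.isSymmetric _ _, LinearMap.sub_apply, Module.End.one_apply, map_sub,
      CStarModule.inner_sub_right, CStarModule.inner_sub_left]
    abel
  rwa [← sub_nonneg, hidentity]

lemma inner_one_sub_apply_le (hG : IsPositiveContraction G) (x : E) :
    inner A ((1 - G) x) (G ((1 - G) x)) ≤ inner A x (G x) :=
  (le_add_of_nonneg_left CStarModule.inner_self_nonneg).trans (hG.inner_apply_self_add_le x)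

lemma inner_apply_self_le (hG : IsPositiveContraction G) (x : E) :
    inner A (G x) (G x) ≤ inner A x (G x) :=
  (le_add_of_nonneg_right (hG.inner_nonneg _)).trans (hG.inner_apply_self_add_le x)

lemma inner_add_inner_one_sub_apply_self_le (hG : IsPositiveContraction G) (x : E) :
    inner A x (G x) + inner A ((1 - G) x) ((1 - G) x) ≤ inner A x x := by
  have hidentity : inner A x (G x) + inner A ((1 - G) x) ((1 - G) x) =
      inner A x x - (inner A x (G x) - inner A (G x) (G x)) := by
    simp only [hG.isSymmetric _ _, LinearMap.sub_apply, Module.End.one_apply,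
      CStarModule.inner_sub_right, CStarModule.inner_sub_left]
    abel
  rw [hidentity]
  exact sub_le_self _ (sub_nonneg.2 (hG.inner_apply_self_le x))

lemma nsmul_inner_pow_add_le (hG : IsPositiveContraction G) (m : ℕ) (x : E) :
    m • inner A (((1 - G) ^ m) x) (G (((1 - G) ^ m) x)) +
      inner A (((1 - G) ^ m) x) (((1 - G) ^ m) x) ≤ inner A x x := by
  induction m with
  | zero => simp
  | succ m ih =>
    rw [pow_succ', Module.End.mul_apply]
    set y := ((1 - G) ^ m) x
    have hform := hG.inner_one_sub_apply_le y
    calc (m + 1) • inner A ((1 - G) y) (G ((1 - G) y)) + inner A ((1 - G) y) ((1 - G) y)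
        ≤ (m + 1) • inner A y (G y) + inner A ((1 - G) y) ((1 - G) y) := by gcongr
      _ = m • inner A y (G y) + (inner A y (G y) + inner A ((1 - G) y) ((1 - G) y)) := by
        rw [succ_nsmul, add_assoc]
      _ ≤ m • inner A y (G y) + inner A y y := by
        gcongr
        exact hG.inner_add_inner_one_sub_apply_self_le y
      _ ≤ inner A x x := ih

lemma nsmul_inner_pow_le (hG : IsPositiveContraction G) (m : ℕ) (x : E) :
    m • inner A (((1 - G) ^ m) x) (G (((1 - G) ^ m) x)) ≤ inner A x x :=
  (le_add_of_nonneg_right CStarModule.inner_self_nonneg).trans (hG.nsmul_inner_pow_add_le m x)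

lemma norm_one_sub_pow_apply_le (hG : IsPositiveContraction G) (m : ℕ) (x : E) :
    ‖((1 - G) ^ m) x‖ ≤ ‖x‖ :=
  norm_le_of_inner_self_le (A := A) <|
    (le_add_of_nonneg_left (nsmul_nonneg (hG.inner_nonneg _) m)).trans
      (hG.nsmul_inner_pow_add_le m x)

lemma mul_norm_one_sub_pow_apply_sq_le_one (hG : IsPositiveContraction G) {g : E}
    (hg : ∀ x, inner A g x * inner A x g ≤ inner A x (G x)) (m : ℕ) :
    m * ‖((1 - G) ^ m) g‖ ^ 2 ≤ 1 := by
  set h := ((1 - G) ^ m) g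
  have hsymm := hG.one_sub.isSymmetric.pow m
  have hsq : m • (inner A h h * inner A h h) ≤ inner A h h :=
    calc m • (inner A h h * inner A h h)
        = m • (inner A g (((1 - G) ^ m) h) * inner A (((1 - G) ^ m) h) g) := by
          rw [hsymm h g, ← hsymm g h]
      _ ≤ m • inner A (((1 - G) ^ m) h) (G (((1 - G) ^ m) h)) := nsmul_le_nsmul_right (hg _) m
      _ ≤ inner A h h := hG.nsmul_inner_pow_le m h
  have hnorm : m * (‖h‖ ^ 2) ^ 2 ≤ ‖h‖ ^ 2 := by
    have hself : IsSelfAdjoint (inner A h h) := isSelfAdjoint_inner_self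
    have hle := CStarAlgebra.norm_le_norm_of_nonneg_of_le
      (nsmul_nonneg (inner_mul_inner_swap_nonneg h h) m) hsq
    rwa [← Nat.cast_smul_eq_nsmul ℝ, norm_smul, hself.norm_mul_self, ← norm_sq_eq A,
      Real.norm_natCast] at hle
  rcases (sq_nonneg ‖h‖).eq_or_lt with hzero | hpos
  · rw [← hzero, mul_zero]
    exact zero_le_one
  · exact le_of_mul_le_mul_right (by linarith) hpos

end IsPositiveContraction

section FrameOperator

variable {ι : Type*} (g : ι → E) (s : Finset ι)

lemma inner_mul_inner_swap_le_inner_frameOperator {i : ι} (hi : i ∈ s) (x : E) :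
    inner A (g i) x * inner A x (g i) ≤ inner A x (frameOperator A g s x) := by
  rw [inner_frameOperator]
  exact Finset.single_le_sum (f := fun i => inner A (g i) x * inner A x (g i))
    (fun i _ => inner_mul_inner_swap_nonneg _ _) hi

lemma isPositiveContraction_frameOperator (hs : ∑ i ∈ s, ‖g i‖ ^ 2 ≤ 1) :
    IsPositiveContraction (frameOperator A g s) where
  isSymmetric := isSymmetric_frameOperator g s
  inner_nonneg x := by
    rw [inner_frameOperator]
    exact Finset.sum_nonneg fun i _ => inner_mul_inner_swap_nonneg _ _
  inner_le x := by
    rw [inner_frameOperator]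
    calc ∑ i ∈ s, inner A (g i) x * inner A x (g i)
        ≤ ∑ i ∈ s, ‖g i‖ ^ 2 • inner A x x := Finset.sum_le_sum fun i _ => inner_mul_inner_swap_le
      _ = (∑ i ∈ s, ‖g i‖ ^ 2) • inner A x x := (Finset.sum_smul ..).symm
      _ ≤ (1 : ℝ) • inner A x x := smul_le_smul_of_nonneg_right hs CStarModule.inner_self_nonneg
      _ = inner A x x := one_smul _ _

end FrameOperator

lemma tendsto_one_sub_frameOperator_pow {g : ℕ → E}
    (hg : Dense (Submodule.span A (Set.range g) : Set E))
    (hs : ∀ s : Finset ℕ, ∑ i ∈ s, ‖g i‖ ^ 2 ≤ 1) {k : ℕ → ℕ} (hk : Tendsto k atTop atTop)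
    (x : E) :
    Tendsto (fun n => ((1 - frameOperator A g (Finset.range n)) ^ k n) x) atTop (𝓝 0) := by
  have hG n := isPositiveContraction_frameOperator (A := A) g (Finset.range n) (hs _)
  refine tendsto_apply_zero_of_dense_span (C := 1)
    (fun n x => by simpa using (hG n).norm_one_sub_pow_apply_le (k n) x) hg ?_ x
  rintro _ ⟨j, rfl⟩
  set v : ℕ → E := fun n => ((1 - frameOperator A g (Finset.range n)) ^ k n) (g j)
  have hsq : Tendsto (fun n => ‖v n‖ ^ 2) atTop (𝓝 0) := by
    refine squeeze_zero' (.of_forall fun n => sq_nonneg _) ?_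
      ((tendsto_one_div_atTop_nhds_zero_nat (𝕜 := ℝ)).comp hk)
    filter_upwards [eventually_gt_atTop j, hk.eventually_gt_atTop 0] with n hn hkn
    rw [Function.comp_apply, le_div_iff₀' (Nat.cast_pos.2 hkn)]
    exact (hG n).mul_norm_one_sub_pow_apply_sq_le_one
      (inner_mul_inner_swap_le_inner_frameOperator g _ (Finset.mem_range.2 hn)) (k n)
  exact tendsto_zero_iff_norm_tendsto_zero.2 (by simpa using hsq.sqrt)

lemma ModuleSchur.tendsto_zero (h : ModuleSchur A E) {u : ℕ → E}
    (hu : ∀ z, Tendsto (fun n => inner A z (u n)) atTop (𝓝 0)) : Tendsto u atTop (𝓝 0) := by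
  obtain ⟨y, hy⟩ := h u ⟨0, tendsto_weakModuleTopology_iff.2 (by simpa only [sub_zero] using hu)⟩
  have hy_zero : y = 0 := ext_inner_left A fun z => by
    rw [CStarModule.inner_zero_right]
    exact tendsto_nhds_unique (((innerSL (A := A) z).continuous.tendsto y).comp hy) (hu z)
  rwa [hy_zero] at hy

lemma ModuleSchur.exists_norm_apply_le (h : ModuleSchur A E) {S : ℕ → Module.End A E}
    (hsymm : ∀ n, IsSymmetric (S n)) (hS : ∀ z, Tendsto (fun n => S n z) atTop (𝓝 0))
    {ε : ℝ} (hε : 0 < ε) : ∃ n, ∀ x, ‖S n x‖ ≤ ε * ‖x‖ := by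
  -- Otherwise some bounded `v` has `‖S n (v n)‖ = 1`, although `⟪z, S n (v n)⟫ = ⟪S n z, v n⟫ → 0`.
  by_contra! hlarge
  choose x hx using hlarge
  have hpos (n : ℕ) : 0 < ‖S n (x n)‖ := (by positivity : 0 ≤ ε * ‖x n‖).trans_lt (hx n)
  set v : ℕ → E := fun n => ((‖S n (x n)‖ : ℂ)⁻¹) • x n
  have hunit (n : ℕ) : ‖S n (v n)‖ = 1 := by
    rw [LinearMap.map_smul_of_tower, norm_smul, norm_inv, Complex.norm_real, norm_norm,
      inv_mul_cancel₀ (hpos n).ne']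
  have hbound (n : ℕ) : ‖v n‖ ≤ ε⁻¹ := by
    rw [norm_smul, norm_inv, Complex.norm_real, norm_norm, inv_mul_le_iff₀ (hpos n),
      ← div_eq_mul_inv, le_div_iff₀' hε]
    exact (hx n).le
  have hlim : Tendsto (fun n => S n (v n)) atTop (𝓝 0) := by
    refine h.tendsto_zero fun z => ?_
    have hSz : Tendsto (fun n => ‖S n z‖ * ε⁻¹) atTop (𝓝 0) := by
      simpa using (hS z).norm.mul_const ε⁻¹
    refine squeeze_zero_norm (fun n => ?_) hSz
    rw [← hsymm n z (v n)]
    exact (norm_inner_le E).trans (by gcongr; exact hbound n)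
  simpa [hunit] using hlim.norm

theorem exists_norm_one_sub_frameOperator_apply_le (hgen : CountablyGenerated A E)
    (hschur : ModuleSchur A E) :
    ∃ (g : ℕ → E) (s : Finset ℕ), ∃ c < 1, ∀ x, ‖(1 - frameOperator A g s) x‖ ≤ c * ‖x‖ := by
  obtain ⟨g, hg, hs⟩ := hgen.exists_sum_norm_sq_le_one
  have hsymm (n : ℕ) : IsSymmetric (1 - frameOperator A g (Finset.range n)) :=
    (isSymmetric_frameOperator g _).one_sub
  obtain ⟨n, hn⟩ := hschur.exists_norm_apply_le (fun n => (hsymm n).pow (2 ^ n))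
    (tendsto_one_sub_frameOperator_pow hg hs (tendsto_pow_atTop_atTop_of_one_lt one_lt_two))
    one_half_pos
  obtain ⟨c, hc0, hc1, hc⟩ : ∃ c : ℝ, 0 ≤ c ∧ c < 1 ∧ c ^ 2 ^ n = 1 / 2 :=
    ⟨(1 / 2) ^ (((2 ^ n : ℕ) : ℝ)⁻¹), by positivity,
      Real.rpow_lt_one (by norm_num) (by norm_num) (by positivity),
      Real.rpow_inv_natCast_pow (by norm_num) (by positivity)⟩
  exact ⟨g, Finset.range n, c, hc1,
    (hsymm n).norm_apply_le_of_norm_pow_two_pow_apply_le hc0 (by rwa [hc])⟩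

lemma exists_tendsto_frameOperator {ι : Type*} (g : ι → E) (s : Finset ι) {u : ℕ → E}
    (hu : CauchySeq u) : ∃ y, Tendsto (fun n => frameOperator A g s (u n)) atTop (𝓝 y) := by
  have hcoeff (i : ι) : ∃ a, Tendsto (fun n => inner A (g i) (u n)) atTop (𝓝 a) :=
    cauchySeq_tendsto_of_complete (hu.map (innerSL (A := A) (g i)).uniformContinuous)
  choose a ha using hcoeff
  exact ⟨∑ i ∈ s, a i • g i, tendsto_finsetSum s fun i _ => (ha i).smul_const (g i)⟩

theorem surjective_frameOperator_of_norm_one_sub_apply_le {ι : Type*} {g : ι → E} {s : Finset ι}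
    {c : ℝ} (hc : c < 1) (h : ∀ x, ‖(1 - frameOperator A g s) x‖ ≤ c * ‖x‖) :
    Function.Surjective (frameOperator A g s) := by
  let T : E →L[ℂ] E := ((1 - frameOperator A g s).restrictScalars ℂ).mkContinuous c h
  have hT : ‖T‖ < 1 :=
    (LinearMap.mkContinuous_norm_le' _ h).trans_lt (max_lt hc zero_lt_one)
  have hfun : ⇑(1 - T) = frameOperator A g s := funext fun x => sub_sub_cancel x _
  have hcomplete : CompleteSpace E := completeSpace_of_tendsto_one_sub hT fun u hu => by
    simpa only [hfun] using exists_tendsto_frameOperator g s hu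
  simpa only [hfun] using surjective_one_sub_of_norm_lt_one hT

end Ordered

end CStarModule

end HilbertCStar

theorem mainTheorem7_general (A E : Type*) [CStarAlgebra A] [PartialOrder A] [StarOrderedRing A]
    [NormedAddCommGroup E] [NormedSpace ℂ E] [Module A E] [CStarModule A E]
    (hgen : HilbertCStar.CountablyGenerated A E) (hschur : HilbertCStar.ModuleSchur A E) :
    HilbertCStar.SelfDual A E := by
  obtain ⟨g, s, c, hc, hgs⟩ := HilbertCStar.exists_norm_one_sub_frameOperator_apply_le hgen hschur
  exact HilbertCStar.selfDual_of_surjective_frameOperator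
    (HilbertCStar.surjective_frameOperator_of_norm_one_sub_apply_le hc hgs)

theorem mainTheorem7 (A E : Type*) [CStarAlgebra A] [PartialOrder A] [StarOrderedRing A]
    [NormedAddCommGroup E] [NormedSpace ℂ E] [Module A E] [CStarModule A E] [CompleteSpace E]
    (hgen : HilbertCStar.CountablyGenerated A E) (hschur : HilbertCStar.ModuleSchur A E) :
    HilbertCStar.SelfDual A E :=
  mainTheorem7_general A E hgen hschur
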